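/- There is an absolute constant $\epsilon>0$ such that the following holds. Let $d\ge 1$ and let $\alpha_1,\dots,\alpha_d\in(0,1)$ satisfy $1-\alpha_i<\epsilon$ for every $i$. Then there exist constants $c_6>0$ and $\rho^*>0$, depending only on $d$ and $\alpha_1,\dots,\alpha_d$, such that for all positive integers $k=n_0,n_1,\dots,n_d=n$ with $\frac{n_i}{n_{i-1}}=\frac{1}{1-\alpha_i}$ for $i=1,\dots,d$, and for every fixed $\mathbf z_0\in\mathbb R^{k}$, the following is true. Let $H_i\in\mathbb R^{n_i\times n_{i-1}}$ and $\boldsymbol\delta_i\in\mathbb R^{n_i}$ $(1\le i\le d)$ be random weight matrices and bias vectors all of whose entries are jointly independent and $\mathcal N(0,1)$-distributed, let $\sigma(x)=\max(x,0)$ act entrywise, and let $$G(\mathbf z)=\sigma\bigl(H_d\,\sigma(H_{d-1}\cdots\sigma(H_1\mathbf z+\boldsymbol\delta_1)\cdots+\boldsymbol\delta_{d-1})+\boldsymbol\delta_d\bigr),\qquad \mathbf z\in\mathbb R^{k}.$$ Then with probability at least $1-e^{-c_6 n}$, simultaneously for every error vector $\mathbf e\in\mathbb R^n$ with at most $\rho^*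 n$ nonzero entries, $\mathbf z=\mathbf z_0$ is the unique solution of $$\min_{\mathbf z\in\mathbb R^{k}}\bigl\|G(\mathbf z)-(G(\mathbf z_0)+\mathbf e)\bigr\|_1 .$$ -/

import Mathlib

open MeasureTheory ProbabilityTheory

noncomputable section

/-- The ReLU activation function. -/
def relu (x : ℝ) : ℝ := max x 0

/-- The `ℓ₁` norm of a vector. -/
def l1Norm {m : ℕ} (x : Fin m → ℝ) : ℝ := ∑ j, |x j|

/-- Weight matrices of a `d`-layer network with layer widths `n 0, …, n d`. The layer `i : Fin d`
maps `ℝ ^ n i.castSucc` to `ℝ ^ n i.succ`. -/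
abbrev Weights {d : ℕ} (n : Fin (d + 1) → ℕ) : Type :=
  (i : Fin d) → Matrix (Fin (n i.succ)) (Fin (n i.castSucc)) ℝ

/-- Bias vectors of a `d`-layer network with layer widths `n 0, …, n d`. -/
abbrev Biases {d : ℕ} (n : Fin (d + 1) → ℕ) : Type :=
  (i : Fin d) → Fin (n i.succ) → ℝ

/-- The output of the first `i` layers on the input `z`: each layer maps `x` to
`relu (H i * x + δ i)`, with `relu` applied to every coordinate. -/
def layerOutput {d : ℕ} {n : Fin (d + 1) → ℕ} (H : Weights n) (δ : Biases n)
    (z : Fin (n 0) → ℝ) (i : Fin (d + 1)) : Fin (n i) → ℝ :=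
  Fin.induction (motive := fun i => Fin (n i) → ℝ) z
    (fun i x => fun j => relu ((Matrix.mulVec (H i) x + δ i) j)) i

/-- The generator `G(z) = relu (H_d relu (H_{d-1} ⋯ relu (H_1 z + δ_1) ⋯ + δ_{d-1}) + δ_d)`. -/
def generator {d : ℕ} {n : Fin (d + 1) → ℕ} (H : Weights n) (δ : Biases n)
    (z : Fin (n 0) → ℝ) : Fin (n (Fin.last d)) → ℝ :=
  layerOutput H δ z (Fin.last d)

/-- Positions of the scalar parameters of a network: the weight entries and the bias entries. -/
abbrev ParamIndex {d : ℕ} (n : Fin (d + 1) → ℕ) : Type :=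
  (Σ i : Fin d, Fin (n i.succ) × Fin (n i.castSucc)) ⊕ (Σ i : Fin d, Fin (n i.succ))

/-- The scalar parameter at a given position. -/
def param {d : ℕ} {n : Fin (d + 1) → ℕ} (H : Weights n) (δ : Biases n) : ParamIndex n → ℝ
  | Sum.inl ⟨i, j, k⟩ => H i j k
  | Sum.inr ⟨i, j⟩ => δ i j

/-- All entries of the random weights and biases are jointly independent and `N(0,1)`. -/
structure IsGaussianNetwork {Ω : Type*} [MeasurableSpace Ω] {d : ℕ} {n : Fin (d + 1) → ℕ}
    (H : Ω → Weights n) (δ : Ω → Biases n) (P : Measure Ω) : Prop where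
  law : ∀ s : ParamIndex n, HasLaw (fun ω => param (H ω) (δ ω) s) (gaussianReal 0 1) P
  indep : iIndepFun (fun (s : ParamIndex n) ω => param (H ω) (δ ω) s) P

/-- `z₀` is the unique solution of the unconstrained problem of minimizing `f`. -/
def IsUniqueMinimizer {X : Type*} (f : X → ℝ) (z₀ : X) : Prop :=
  (∀ z, f z₀ ≤ f z) ∧ ∀ z, (∀ w, f z ≤ f w) → z = z₀

end

/-! Append a coordinate 1 to the input of each layer, so that biases become weights and a layer is
`relu` of a standard Gaussian matrix applied to that vector. Everything follows from one
deterministic property of the matrix, `IsWellConditioned`: operator norm at most 4√m, and for all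
directions p, q a constant fraction of rows h has both |⟪p, h⟫| and the positive part of ⟪q, h⟫ of
constant size, in the averaged form of a sum of minima.

With p = x - y and q the longer of x and y, the second condition bounds the ℓ₁ change of a `relu`
layer below by (m/1792)‖x - y‖. Hence every layer is injective. By Cauchy–Schwarz, the norm bound
limits the change on a set of at most 2⁻²⁸m coordinates to (m/4096)‖x - y‖, less than half the
total. Applied to the last layer, this says that moving away from z₀ costs more off the support of e
than it can gain on it. The event does not depend on e, so the conclusion holds for all e at once.

A Gaussian matrix is well conditioned with high probability by Chernoff bounds on a net of the
sphere, applied to pairs (p, q). The union bound over the net is affordable when m ≥ 912k, which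
fixes ε = 1/912. A union bound over layers finishes the proof. -/

noncomputable section

/-! ### Nets of the unit sphere -/

section Net

variable {E : Type*} [NormedAddCommGroup E] [NormedSpace ℝ E] [FiniteDimensional ℝ E]

open Metric Module Set in
/-- A volume bound for the size of an `η`-separated set of unit vectors. -/
theorem card_le_of_separated_unit {η : ℝ} (hη : 0 < η) (s : Finset E) (hs : ∀ c ∈ s, ‖c‖ = 1)
    (h : ∀ c ∈ s, ∀ d ∈ s, c ≠ d → η ≤ ‖c - d‖) :
    (s.card : ℝ) ≤ (1 + 2 / η) ^ finrank ℝ E := by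
  borelize E
  let μ : Measure E := Measure.addHaar
  have hδ : 0 < η / 2 := by positivity
  have hρ : 0 < 1 + η / 2 := by positivity
  -- Compare volumes: disjoint balls of radius η/2 about the points of s lie in the ball of radius 1
  -- + η/2.
  have hdisj : (s : Set E).PairwiseDisjoint fun c => ball c (η / 2) := by
    intro c hc d hd hcd
    apply ball_disjoint_ball
    rw [dist_eq_norm]
    linarith [h c hc d hd hcd]
  have hsub : (⋃ c ∈ s, ball c (η / 2)) ⊆ ball (0 : E) (1 + η / 2) := by
    refine iUnion₂_subset fun x hx => ball_subset_ball' ?_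
    rw [dist_zero_right, hs x hx, add_comm]
  have hvol : (s.card : ENNReal) * ENNReal.ofReal ((η / 2) ^ finrank ℝ E) * μ (ball 0 1) ≤
      ENNReal.ofReal ((1 + η / 2) ^ finrank ℝ E) * μ (ball 0 1) := by
    rw [← μ.addHaar_ball_of_pos 0 hρ]
    refine le_trans (le_of_eq ?_) (measure_mono hsub)
    rw [measure_biUnion_finset hdisj fun c _ => measurableSet_ball]
    simp only [μ.addHaar_ball_of_pos _ hδ, Finset.sum_const, nsmul_eq_mul, mul_assoc]
  have hcard := (ENNReal.mul_le_mul_iff_left (measure_ball_pos _ _ zero_lt_one).ne'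
    measure_ball_lt_top.ne).1 hvol
  have hreal := ENNReal.toReal_le_of_le_ofReal (by positivity) hcard
  rw [ENNReal.toReal_mul, ENNReal.toReal_natCast, ENNReal.toReal_ofReal (by positivity)] at hreal
  rw [show 1 + 2 / η = (1 + η / 2) / (η / 2) by field_simp; ring, div_pow,
    le_div_iff₀ (by positivity)]
  exact hreal

/-- The unit sphere has an `η`-net of size at most `(1 + 2 / η) ^ dim`. -/
theorem exists_unit_net {η : ℝ} (hη : 0 < η) :
    ∃ N : Finset E, (N.card : ℝ) ≤ (1 + 2 / η) ^ Module.finrank ℝ E ∧ (∀ v ∈ N, ‖v‖ = 1) ∧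
      ∀ p : E, ‖p‖ = 1 → ∃ v ∈ N, ‖p - v‖ ≤ η := by
  classical
  let T : Set ℕ := {k | ∃ s : Finset E, ((∀ c ∈ s, ‖c‖ = 1) ∧
    ∀ c ∈ s, ∀ d ∈ s, c ≠ d → η ≤ ‖c - d‖) ∧ s.card = k}
  have hbdd : BddAbove T := by
    refine ⟨⌊(1 + 2 / η) ^ Module.finrank ℝ E⌋₊, ?_⟩
    rintro _ ⟨s, hs, rfl⟩
    exact Nat.le_floor (card_le_of_separated_unit hη s hs.1 hs.2)
  -- A separated set of maximal cardinality is a net, since an uncovered unit vector could be added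
  -- to it.
  obtain ⟨N, hN, hmax⟩ := Nat.sSup_mem (s := T) ⟨0, ∅, by simp⟩ hbdd
  refine ⟨N, card_le_of_separated_unit hη N hN.1 hN.2, hN.1, fun p hp => ?_⟩
  by_contra! hfar
  have hpN : p ∉ N := fun hmem => by
    have := hfar p hmem
    rw [sub_self, norm_zero] at this
    linarith
  have hT : (insert p N).card ∈ T := by
    refine ⟨insert p N, ⟨?_, ?_⟩, rfl⟩
    · simpa [hp] using hN.1
    · intro c hc d hd hcd
      rcases Finset.mem_insert.1 hc with rfl | hc' <;> rcases Finset.mem_insert.1 hd with rfl | hd'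
      · exact absurd rfl hcd
      · exact (hfar d hd').le
      · rw [norm_sub_rev]
        exact (hfar c hc').le
      · exact hN.2 c hc' d hd' hcd
  have := le_csSup hbdd hT
  rw [Finset.card_insert_of_notMem hpN] at this
  omega

end Net

/-! ### Elementary properties of `relu` -/

theorem relu_nonneg (x : ℝ) : 0 ≤ relu x := le_max_right _ _

theorem le_relu (x : ℝ) : x ≤ relu x := le_max_left _ _

theorem relu_mul_of_nonneg {r : ℝ} (hr : 0 ≤ r) (x : ℝ) : relu (r * x) = r * relu x := by
  simp [relu, mul_max_of_nonneg _ _ hr]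

theorem abs_relu_sub_relu_le (x y : ℝ) : |relu x - relu y| ≤ |x - y| :=
  abs_max_sub_max_le_abs x y 0

@[fun_prop]
theorem measurable_relu : Measurable relu := by
  unfold relu
  fun_prop

/-! ### Estimates for the standard Gaussian measure -/

theorem gaussianReal_abs_lt_le {r : ℝ} (hr : 0 ≤ r) :
    (gaussianReal 0 1).real {x | |x| < r} ≤ r := by
  have hset : {x : ℝ | |x| < r} = Set.Ioo (-r) r := by
    ext x
    simp [abs_lt]
  rw [hset, measureReal_def, gaussianReal_apply_eq_integral 0 one_ne_zero,
    ENNReal.toReal_ofReal (integral_nonneg fun x => gaussianPDFReal_nonneg _ _ _)]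
  have hpdf : ∀ x : ℝ, gaussianPDFReal 0 1 x ≤ 1 / 2 := by
    intro x
    rw [gaussianPDFReal]
    have h2 : (2 : ℝ) ≤ √(2 * Real.pi * (1 : NNReal)) := by
      apply Real.le_sqrt_of_sq_le
      have := Real.pi_gt_three
      push_cast
      nlinarith
    have h1 : Real.exp (-(x - 0) ^ 2 / (2 * (1 : NNReal))) ≤ 1 := by
      rw [Real.exp_le_one_iff]
      push_cast
      nlinarith [sq_nonneg (x - 0)]
    calc (√(2 * Real.pi * (1 : NNReal)))⁻¹ * Real.exp (-(x - 0) ^ 2 / (2 * (1 : NNReal)))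
        ≤ (2 : ℝ)⁻¹ * 1 := by gcongr
      _ = 1 / 2 := by norm_num
  calc ∫ x in Set.Ioo (-r) r, gaussianPDFReal 0 1 x
      ≤ ∫ _ in Set.Ioo (-r) r, (1 / 2 : ℝ) := by
        refine setIntegral_mono (integrable_gaussianPDFReal 0 1).integrableOn ?_ hpdf
        exact integrableOn_const (by simp)
    _ = r := by
        rw [setIntegral_const, measureReal_def, Real.volume_Ioo,
          ENNReal.toReal_ofReal (by linarith)]
        simp only [smul_eq_mul]
        ring

theorem gaussianReal_Iio_zero_le : (gaussianReal 0 1).real (Set.Iio 0) ≤ 1 / 2 := by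
  have hneg : (gaussianReal 0 1).real (Set.Iio 0) = (gaussianReal 0 1).real (Set.Ioi 0) := by
    conv_lhs => rw [← neg_zero (G := ℝ), ← gaussianReal_map_neg]
    rw [map_measureReal_apply (by fun_prop) measurableSet_Iio]
    congr 1
    ext x
    simp
  have hdisj : Disjoint (Set.Iio (0 : ℝ)) (Set.Ioi 0) := by
    rw [Set.disjoint_left]
    intro x hx hx'
    exact lt_asymm (Set.mem_Iio.1 hx) (Set.mem_Ioi.1 hx')
  have hle := measureReal_le_one (μ := gaussianReal 0 1) (s := Set.Iio (0 : ℝ) ∪ Set.Ioi 0)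
  rw [measureReal_union hdisj measurableSet_Ioi] at hle
  linarith

theorem gaussianPDFReal_mul_exp_sq (x : ℝ) :
    gaussianPDFReal 0 1 x * Real.exp (1 / 4 * x ^ 2) =
      (√(2 * Real.pi))⁻¹ * Real.exp (-(1 / 4) * x ^ 2) := by
  rw [gaussianPDFReal, mul_assoc, ← Real.exp_add]
  push_cast
  ring_nf

theorem integrable_exp_sq_gaussianReal :
    Integrable (fun x => Real.exp (1 / 4 * x ^ 2)) (gaussianReal 0 1) := by
  rw [gaussianReal_of_var_ne_zero 0 one_ne_zero, integrable_withDensity_iff_integrable_smul']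
  · simp only [toReal_gaussianPDF, smul_eq_mul, gaussianPDFReal_mul_exp_sq]
    exact (integrable_exp_neg_mul_sq (by norm_num)).const_mul _
  · fun_prop
  · exact Filter.Eventually.of_forall fun x => gaussianPDF_lt_top

/-- The exact value is √2. -/
theorem integral_exp_sq_gaussianReal_le :
    ∫ x, Real.exp (1 / 4 * x ^ 2) ∂(gaussianReal 0 1) ≤ 3 / 2 := by
  rw [integral_gaussianReal_eq_integral_smul one_ne_zero]
  simp only [smul_eq_mul, gaussianPDFReal_mul_exp_sq]
  rw [integral_const_mul, integral_gaussian, ← Real.sqrt_inv, ← Real.sqrt_mul (by positivity)]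
  refine Real.sqrt_le_iff.2 ⟨by norm_num, ?_⟩
  have : (2 * Real.pi)⁻¹ * (Real.pi / (1 / 4)) = 2 := by
    field_simp
    norm_num
  rw [this]
  norm_num

section StdGaussian

open scoped RealInnerProductSpace

variable {E : Type*} [NormedAddCommGroup E] [InnerProductSpace ℝ E] [FiniteDimensional ℝ E]
  [MeasurableSpace E] [BorelSpace E]

theorem hasLaw_inner_stdGaussian {v : E} (hv : ‖v‖ = 1) :
    HasLaw (fun x : E => ⟪v, x⟫) (gaussianReal 0 1) (stdGaussian E) where
  aemeasurable := by fun_prop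
  map_eq := by
    have h := IsGaussian.map_eq_gaussianReal (μ := stdGaussian E) (innerSL ℝ v)
    rw [variance_dual_stdGaussian, integral_strongDual_stdGaussian, innerSL_apply_norm, hv] at h
    simpa using h

/-- A union bound, 1/8 + 1/8 + 1/2, which is insensitive to the correlation of the two inner
products and hence uniform in p and q. -/
theorem stdGaussian_min_lt_le {p q : E} (hp : ‖p‖ = 1) (hq : ‖q‖ = 1) :
    (stdGaussian E).real {x | min |⟪p, x⟫| (relu ⟪q, x⟫) < 1 / 8} ≤ 3 / 4 := by
  have hsub : {x : E | min |⟪p, x⟫| (relu ⟪q, x⟫) < 1 / 8} ⊆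
      ({x : E | |⟪p, x⟫| < 1 / 8} ∪ {x : E | |⟪q, x⟫| < 1 / 8}) ∪ {x : E | ⟪q, x⟫ < 0} := by
    intro x hx
    simp only [Set.mem_union, Set.mem_ofPred_eq] at hx ⊢
    rcases min_lt_iff.1 hx with h | h
    · exact Or.inl (Or.inl h)
    · by_cases h0 : ⟪q, x⟫ < 0
      · exact Or.inr h0
      · refine Or.inl (Or.inr ?_)
        rw [abs_of_nonneg (not_lt.1 h0)]
        exact (le_relu _).trans_lt h
  have hmeas : MeasurableSet {x : ℝ | |x| < 1 / 8} :=
    measurableSet_lt (by fun_prop) measurable_const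
  have h1 := (hasLaw_inner_stdGaussian hp).measureReal_eq (p := fun x => |x| < 1 / 8) hmeas
  have h2 := (hasLaw_inner_stdGaussian hq).measureReal_eq (p := fun x => |x| < 1 / 8) hmeas
  have h3 := (hasLaw_inner_stdGaussian hq).measureReal_eq (p := fun x => x < 0) measurableSet_Iio
  have hr := gaussianReal_abs_lt_le (r := 1 / 8) (by norm_num)
  have h0 : (gaussianReal 0 1).real {x | x < 0} ≤ 1 / 2 := gaussianReal_Iio_zero_le
  calc (stdGaussian E).real {x | min |⟪p, x⟫| (relu ⟪q, x⟫) < 1 / 8}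
      ≤ (stdGaussian E).real (({x : E | |⟪p, x⟫| < 1 / 8} ∪ {x : E | |⟪q, x⟫| < 1 / 8}) ∪
          {x : E | ⟪q, x⟫ < 0}) := measureReal_mono hsub
    _ ≤ _ := (measureReal_union_le _ _).trans (add_le_add_left (measureReal_union_le _ _) _)
    _ ≤ 3 / 4 := by
      rw [h1, h2, h3]
      linarith

theorem measurable_min_inner (p q : E) :
    Measurable fun x : E => min |⟪p, x⟫| (relu ⟪q, x⟫) := by
  fun_prop

theorem min_abs_relu_nonneg (a b : ℝ) : 0 ≤ min |a| (relu b) :=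
  le_min (abs_nonneg _) (relu_nonneg _)

theorem integrable_exp_min_inner (p q : E) :
    Integrable (fun x : E => Real.exp (-32 * min |⟪p, x⟫| (relu ⟪q, x⟫))) (stdGaussian E) := by
  have hm := ((measurable_min_inner p q).const_mul (-32)).exp
  refine Integrable.of_bound hm.aestronglyMeasurable 1 (Filter.Eventually.of_forall fun x => ?_)
  rw [Real.norm_eq_abs, abs_of_pos (Real.exp_pos _), Real.exp_le_one_iff]
  linarith [min_abs_relu_nonneg ⟪p, x⟫ ⟪q, x⟫]

/-- Bound the exponential by 1 where the minimum is below 1/8 and by e⁻⁴ ≤ 1/16 elsewhere; 3/4 +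
1/16 = 13/16. -/
theorem mgf_min_inner_le {p q : E} (hp : ‖p‖ = 1) (hq : ‖q‖ = 1) :
    mgf (fun x : E => min |⟪p, x⟫| (relu ⟪q, x⟫)) (stdGaussian E) (-32) ≤ 13 / 16 := by
  set A : Set E := {x | min |⟪p, x⟫| (relu ⟪q, x⟫) < 1 / 8} with hA
  have hAm : MeasurableSet A := measurableSet_lt (measurable_min_inner p q) measurable_const
  have hexp : Real.exp (-4) ≤ 1 / 16 := by
    have h2 : (2 : ℝ) ≤ Real.exp 1 := by linarith [Real.add_one_le_exp (1 : ℝ)]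
    have h16 : (16 : ℝ) ≤ Real.exp 4 := by
      calc (16 : ℝ) = 2 ^ 4 := by norm_num
        _ ≤ Real.exp 1 ^ 4 := by gcongr
        _ = Real.exp 4 := by rw [← Real.exp_nat_mul]; norm_num
    rw [Real.exp_neg, one_div]
    gcongr
  calc mgf (fun x : E => min |⟪p, x⟫| (relu ⟪q, x⟫)) (stdGaussian E) (-32)
      = ∫ x, Real.exp (-32 * min |⟪p, x⟫| (relu ⟪q, x⟫)) ∂(stdGaussian E) := rfl
    _ ≤ ∫ x, (A.indicator 1 x + 1 / 16 : ℝ) ∂(stdGaussian E) := by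
        refine integral_mono (integrable_exp_min_inner p q) ?_ fun x => ?_
        · exact ((integrable_const 1).indicator hAm).add (integrable_const _)
        · by_cases hx : x ∈ A
          · simp only [Set.indicator_of_mem hx, Pi.one_apply]
            have : Real.exp (-32 * min |⟪p, x⟫| (relu ⟪q, x⟫)) ≤ 1 := by
              rw [Real.exp_le_one_iff]
              linarith [min_abs_relu_nonneg ⟪p, x⟫ ⟪q, x⟫]
            linarith
          · simp only [Set.indicator_of_notMem hx, zero_add]
            refine le_trans (Real.exp_le_exp.2 ?_) hexp
            have : 1 / 8 ≤ min |⟪p, x⟫| (relu ⟪q, x⟫) := not_lt.1 hx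
            linarith
    _ = (stdGaussian E).real A + 1 / 16 := by
        rw [integral_add ((integrable_const 1).indicator hAm) (integrable_const _),
          integral_indicator_one hAm]
        simp
    _ ≤ 13 / 16 := by linarith [stdGaussian_min_lt_le hp hq]

theorem integrable_exp_inner_sq {v : E} (hv : ‖v‖ = 1) :
    Integrable (fun x : E => Real.exp (1 / 4 * ⟪v, x⟫ ^ 2)) (stdGaussian E) := by
  have h := integrable_exp_sq_gaussianReal
  rw [← (hasLaw_inner_stdGaussian hv).map_eq] at h
  exact h.comp_aemeasurable (hasLaw_inner_stdGaussian hv).aemeasurable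

theorem mgf_inner_sq_le {v : E} (hv : ‖v‖ = 1) :
    mgf (fun x : E => ⟪v, x⟫ ^ 2) (stdGaussian E) (1 / 4) ≤ 3 / 2 := by
  refine le_of_eq_of_le ?_ integral_exp_sq_gaussianReal_le
  exact (hasLaw_inner_stdGaussian hv).integral_comp
    (f := fun x => Real.exp (1 / 4 * x ^ 2)) (by fun_prop)

end StdGaussian

/-! ### Exponential tail bounds for sums over independent samples -/

section Tail

variable {F : Type*} [MeasurableSpace F] {μ : Measure F} [IsProbabilityMeasure μ]

theorem mgf_sum_pi {m : ℕ} {f : F → ℝ} (hf : Measurable f) (t : ℝ) :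
    mgf (fun h : Fin m → F => ∑ j, f (h j)) (Measure.pi fun _ => μ) t = mgf f μ t ^ m := by
  have hind : iIndepFun (fun (j : Fin m) (h : Fin m → F) => f (h j)) (Measure.pi fun _ => μ) :=
    iIndepFun_pi fun _ => hf.aemeasurable
  have hsum := hind.mgf_sum (t := t) (fun j => by fun_prop) Finset.univ
  have hfun : (∑ j, fun h : Fin m → F => f (h j)) = fun h : Fin m → F => ∑ j, f (h j) := by
    ext h
    simp
  rw [hfun] at hsum
  rw [hsum, Finset.prod_eq_pow_card (b := mgf f μ t), Finset.card_univ, Fintype.card_fin]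
  intro j _
  exact (MeasurePreserving.hasLaw (measurePreserving_eval (fun _ : Fin m => μ) j)).integral_comp
    (f := fun x => Real.exp (t * f x)) (by fun_prop)

theorem integrable_exp_sum_pi {m : ℕ} {f : F → ℝ} {t : ℝ}
    (hint : Integrable (fun x => Real.exp (t * f x)) μ) :
    Integrable (fun h : Fin m → F => Real.exp (t * ∑ j, f (h j))) (Measure.pi fun _ => μ) := by
  simp only [Finset.mul_sum, Real.exp_sum]
  exact Integrable.fintype_prod fun _ => hint

theorem measureReal_pi_sum_ge_le {m : ℕ} {f : F → ℝ} (hf : Measurable f) {t : ℝ} (ht : 0 ≤ t)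
    (hint : Integrable (fun x => Real.exp (t * f x)) μ) (a : ℝ) :
    (Measure.pi fun _ : Fin m => μ).real {h | a * m ≤ ∑ j, f (h j)} ≤
      (Real.exp (-t * a) * mgf f μ t) ^ m := by
  refine (measure_ge_le_exp_mul_mgf (a * m) ht (integrable_exp_sum_pi hint)).trans_eq ?_
  rw [mgf_sum_pi hf, mul_pow, ← Real.exp_nat_mul]
  ring_nf

theorem measureReal_pi_sum_le_le {m : ℕ} {f : F → ℝ} (hf : Measurable f) {t : ℝ} (ht : t ≤ 0)
    (hint : Integrable (fun x => Real.exp (t * f x)) μ) (a : ℝ) :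
    (Measure.pi fun _ : Fin m => μ).real {h | ∑ j, f (h j) ≤ a * m} ≤
      (Real.exp (-t * a) * mgf f μ t) ^ m := by
  refine (measure_le_le_exp_mul_mgf (a * m) ht (integrable_exp_sum_pi hint)).trans_eq ?_
  rw [mgf_sum_pi hf, mul_pow, ← Real.exp_nat_mul]
  ring_nf

end Tail

/-! ### Well-conditioned families of vectors -/

section WellConditioned

open scoped RealInnerProductSpace

variable {E : Type*} [NormedAddCommGroup E] [InnerProductSpace ℝ E]

/-- The rows `h j` of a matrix are well conditioned if the matrix has operator norm `O(√m)` and if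
any two directions are simultaneously seen, the second one with a positive sign, by a constant
fraction of the rows. -/
structure IsWellConditioned {m : ℕ} (h : Fin m → E) : Prop where
  sum_sq_le : ∀ p, ∑ j, ⟪p, h j⟫ ^ 2 ≤ 16 * m * ‖p‖ ^ 2
  le_sum_min : ∀ p q, m / 896 * min ‖p‖ ‖q‖ ≤ ∑ j, min |⟪p, h j⟫| (relu ⟪q, h j⟫)

theorem sum_sq_inner_le_of_net {m : ℕ} {h : Fin m → E} {N : Finset E} {B η : ℝ} (hB : 0 ≤ B)
    (hη : η ≤ 1 / 2) (hcover : ∀ p : E, ‖p‖ = 1 → ∃ v ∈ N, ‖p - v‖ ≤ η)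
    (hN : ∀ v ∈ N, ∑ j, ⟪v, h j⟫ ^ 2 ≤ B ^ 2) (p : E) :
    ∑ j, ⟪p, h j⟫ ^ 2 ≤ (2 * B * ‖p‖) ^ 2 := by
  let T : E →L[ℝ] EuclideanSpace ℝ (Fin m) :=
    (EuclideanSpace.equiv (Fin m) ℝ).symm.toContinuousLinearMap.comp
      (ContinuousLinearMap.pi fun j => innerSL ℝ (h j))
  have hT : ∀ p j, T p j = ⟪p, h j⟫ := fun p j => by
    simp [T, real_inner_comm]
  have hnorm : ∀ p, ‖T p‖ ^ 2 = ∑ j, ⟪p, h j⟫ ^ 2 := fun p => by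
    rw [EuclideanSpace.real_norm_sq_eq]
    simp only [hT]
  have hTN : ∀ v ∈ N, ‖T v‖ ≤ B := fun v hv => by
    refine le_of_sq_le_sq ?_ hB
    rw [hnorm]
    exact hN v hv
  -- Approximating a unit vector by the net reproduces at most half of `‖T‖` as error, which is
  -- absorbed on the left.
  have hop : ‖T‖ ≤ B + ‖T‖ / 2 := by
    refine T.opNorm_le_bound (by positivity) fun p => ?_
    rcases eq_or_ne p 0 with rfl | hp
    · simp
    have hp' : 0 < ‖p‖ := norm_pos_iff.2 hp
    obtain ⟨v, hv, hpv⟩ := hcover (‖p‖⁻¹ • p) (by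
      rw [norm_smul, norm_inv, norm_norm, inv_mul_cancel₀ hp'.ne'])
    have hunit : ‖T (‖p‖⁻¹ • p)‖ ≤ B + ‖T‖ / 2 := by
      have hsplit : T (‖p‖⁻¹ • p) = T v + T (‖p‖⁻¹ • p - v) := by
        rw [map_sub]
        abel
      rw [hsplit]
      refine (norm_add_le _ _).trans (add_le_add (hTN v hv) ?_)
      refine (T.le_opNorm _).trans ?_
      have := mul_le_mul_of_nonneg_left (hpv.trans hη) (norm_nonneg T)
      linarith
    rw [map_smul, norm_smul, norm_inv, norm_norm, inv_mul_le_iff₀ hp'] at hunit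
    linarith
  rw [← hnorm]
  have hT2 : ‖T‖ ≤ 2 * B := by linarith
  gcongr
  exact (T.le_opNorm p).trans (by gcongr)

/-- Cauchy–Schwarz. The factor √|S| is what makes a small error support harmless. -/
theorem sum_abs_inner_le {m : ℕ} {h : Fin m → E} {B : ℝ} (hB : 0 ≤ B)
    (hsq : ∀ p, ∑ j, ⟪p, h j⟫ ^ 2 ≤ B ^ 2 * ‖p‖ ^ 2) (S : Finset (Fin m)) (p : E) :
    ∑ j ∈ S, |⟪p, h j⟫| ≤ √S.card * B * ‖p‖ := by
  refine le_of_sq_le_sq ?_ (by positivity)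
  calc (∑ j ∈ S, |⟪p, h j⟫|) ^ 2 ≤ S.card * ∑ j ∈ S, |⟪p, h j⟫| ^ 2 :=
        sq_sum_le_card_mul_sum_sq
    _ ≤ S.card * (B ^ 2 * ‖p‖ ^ 2) := by
        gcongr
        simp only [sq_abs]
        exact (Finset.sum_le_univ_sum_of_nonneg fun j => sq_nonneg _).trans (hsq p)
    _ = (√S.card * B * ‖p‖) ^ 2 := by
        rw [mul_pow, mul_pow, Real.sq_sqrt (by positivity)]
        ring

theorem min_abs_relu_sub_le (a b a' b' : ℝ) :
    min |a| (relu b) ≤ min |a'| (relu b') + (|a - a'| + |b - b'|) := by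
  have ha : |a| ≤ |a'| + |a - a'| := by
    have := abs_sub_abs_le_abs_sub a a'
    linarith
  have hb : relu b ≤ relu b' + |b - b'| := by
    have := (le_abs_self _).trans (abs_relu_sub_relu_le b b')
    linarith
  rcases le_total |a'| (relu b') with h | h
  · rw [min_eq_left h]
    linarith [min_le_left |a| (relu b), abs_nonneg (b - b')]
  · rw [min_eq_right h]
    linarith [min_le_right |a| (relu b), abs_nonneg (a - a')]

theorem min_abs_relu_mul {r a b : ℝ} (hr : 0 ≤ r) :
    min |r * a| (relu (r * b)) = r * min |a| (relu b) := by
  rw [abs_mul, abs_of_nonneg hr, relu_mul_of_nonneg hr, mul_min_of_nonneg _ _ hr]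

theorem min_abs_relu_mono_scale {r s t a b : ℝ} (hr : 0 ≤ r) (hs : r ≤ s) (ht : r ≤ t) :
    min |r * a| (relu (r * b)) ≤ min |s * a| (relu (t * b)) := by
  rw [abs_mul, abs_mul, abs_of_nonneg hr, abs_of_nonneg (hr.trans hs), relu_mul_of_nonneg hr,
    relu_mul_of_nonneg (hr.trans ht)]
  exact min_le_min (mul_le_mul_of_nonneg_right hs (abs_nonneg _))
    (mul_le_mul_of_nonneg_right ht (relu_nonneg _))

/-- Each summand increases with the lengths of p and q, so both may be shortened to the smaller
length, which then factors out. -/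
theorem le_sum_min_of_unit {m : ℕ} {h : Fin m → E} {c : ℝ}
    (hunit : ∀ p q : E, ‖p‖ = 1 → ‖q‖ = 1 → c ≤ ∑ j, min |⟪p, h j⟫| (relu ⟪q, h j⟫)) (p q : E) :
    c * min ‖p‖ ‖q‖ ≤ ∑ j, min |⟪p, h j⟫| (relu ⟪q, h j⟫) := by
  rcases eq_or_ne p 0 with rfl | hp
  · simpa using Finset.sum_nonneg fun j (_ : j ∈ Finset.univ) =>
      min_abs_relu_nonneg 0 ⟪q, h j⟫
  rcases eq_or_ne q 0 with rfl | hq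
  · simpa using Finset.sum_nonneg fun j (_ : j ∈ Finset.univ) =>
      min_abs_relu_nonneg ⟪p, h j⟫ 0
  have hscale : ∀ v : E, v ≠ 0 → ‖‖v‖⁻¹ • v‖ = 1 ∧ ∀ w, ⟪v, w⟫ = ‖v‖ * ⟪‖v‖⁻¹ • v, w⟫ := by
    intro v hv
    have hv' : ‖v‖ ≠ 0 := norm_ne_zero_iff.2 hv
    refine ⟨by rw [norm_smul, norm_inv, norm_norm, inv_mul_cancel₀ hv'], fun w => ?_⟩
    rw [real_inner_smul_left, mul_inv_cancel_left₀ hv']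
  obtain ⟨hp1, hp2⟩ := hscale p hp
  obtain ⟨hq1, hq2⟩ := hscale q hq
  have hr : 0 ≤ min ‖p‖ ‖q‖ := le_min (norm_nonneg _) (norm_nonneg _)
  calc c * min ‖p‖ ‖q‖
      ≤ min ‖p‖ ‖q‖ * ∑ j, min |⟪‖p‖⁻¹ • p, h j⟫| (relu ⟪‖q‖⁻¹ • q, h j⟫) := by
        rw [mul_comm]
        exact mul_le_mul_of_nonneg_left (hunit _ _ hp1 hq1) hr
    _ ≤ ∑ j, min |⟪p, h j⟫| (relu ⟪q, h j⟫) := by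
        rw [Finset.mul_sum]
        refine Finset.sum_le_sum fun j _ => ?_
        rw [← min_abs_relu_mul hr, hp2 (h j), hq2 (h j)]
        exact min_abs_relu_mono_scale hr (min_le_left _ _) (min_le_right _ _)

/-- It suffices to control a fine net of the unit sphere. -/
theorem isWellConditioned_of_net {m : ℕ} {h : Fin m → E} {N : Finset E}
    (hcover : ∀ p : E, ‖p‖ = 1 → ∃ v ∈ N, ‖p - v‖ ≤ 1 / 7168)
    (hupper : ∀ v ∈ N, ∑ j, ⟪v, h j⟫ ^ 2 ≤ 4 * m)
    (hlower : ∀ v ∈ N, ∀ w ∈ N, 1 / 448 * m ≤ ∑ j, min |⟪v, h j⟫| (relu ⟪w, h j⟫)) :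
    IsWellConditioned h := by
  have hsqrt : √(m : ℝ) ^ 2 = m := Real.sq_sqrt (Nat.cast_nonneg m)
  have hsq : ∀ p, ∑ j, ⟪p, h j⟫ ^ 2 ≤ (4 * √m) ^ 2 * ‖p‖ ^ 2 := fun p => by
    have := sum_sq_inner_le_of_net (B := 2 * √m) (by positivity) (by norm_num) hcover
      (fun v hv => by rw [mul_pow, hsqrt]; linarith [hupper v hv]) p
    refine this.trans_eq ?_
    ring
  refine ⟨fun p => (hsq p).trans_eq (by rw [mul_pow, hsqrt]; ring), le_sum_min_of_unit ?_⟩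
  intro p q hp hq
  obtain ⟨v, hv, hpv⟩ := hcover p hp
  obtain ⟨w, hw, hqw⟩ := hcover q hq
  have hl1 : ∀ x y : E, ‖x - y‖ ≤ 1 / 7168 →
      ∑ j, |⟪y, h j⟫ - ⟪x, h j⟫| ≤ m * (4 / 7168) := by
    intro x y hxy
    have := sum_abs_inner_le (by positivity) hsq Finset.univ (y - x)
    simp only [inner_sub_left, Finset.card_univ, Fintype.card_fin] at this
    refine this.trans ?_
    rw [norm_sub_rev y x]
    calc √m * (4 * √m) * ‖x - y‖ = 4 * (√(m : ℝ) ^ 2) * ‖x - y‖ := by ring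
      _ ≤ 4 * (√(m : ℝ) ^ 2) * (1 / 7168) := by gcongr
      _ = m * (4 / 7168) := by
        rw [hsqrt]
        ring
  -- The two approximations cost 2 · 4/7168 = 1/896 per row, half of the 1/448 available on the net.
  have hle := (hlower v hv w hw).trans (Finset.sum_le_sum fun j _ =>
    min_abs_relu_sub_le ⟪v, h j⟫ ⟪w, h j⟫ ⟪p, h j⟫ ⟪q, h j⟫)
  rw [Finset.sum_add_distrib, Finset.sum_add_distrib] at hle
  linarith [hl1 p v hpv, hl1 q w hqw]

/-- If a > 0, the unit is active at a, and the change is |a - b| or a according to whether it is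
active at b. This is why `IsWellConditioned` asks for a sign in the second direction only. -/
theorem min_abs_relu_le_abs_relu_sub_relu (a b : ℝ) :
    min |a - b| (relu a) ≤ |relu a - relu b| := by
  unfold relu
  rcases le_total a 0 with ha | ha <;> rcases le_total b 0 with hb | hb
  · simp [max_eq_right ha]
  · simp [max_eq_right ha]
  · rw [max_eq_left ha, max_eq_right hb, sub_zero, abs_of_nonneg ha]
    exact min_le_right _ _
  · rw [max_eq_left ha, max_eq_left hb]
    exact min_le_left _ _

namespace IsWellConditioned

variable {m : ℕ} {h : Fin m → E}

/-- A well-conditioned `relu` layer is bi-Lipschitz from below. -/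
theorem le_sum_abs_relu_sub (hh : IsWellConditioned h) (x y : E) :
    m / 1792 * ‖x - y‖ ≤ ∑ j, |relu ⟪x, h j⟫ - relu ⟪y, h j⟫| := by
  -- By the triangle inequality one of x, y has norm at least ‖x - y‖/2, and the claim is symmetric.
  have key : ∀ x y : E, ‖x - y‖ / 2 ≤ ‖x‖ →
      m / 1792 * ‖x - y‖ ≤ ∑ j, |relu ⟪x, h j⟫ - relu ⟪y, h j⟫| := by
    intro x y hxy
    have hmin : ‖x - y‖ / 2 ≤ min ‖x - y‖ ‖x‖ := le_min (half_le_self (norm_nonneg _)) hxy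
    calc m / 1792 * ‖x - y‖ = m / 896 * (‖x - y‖ / 2) := by ring
      _ ≤ m / 896 * min ‖x - y‖ ‖x‖ := by gcongr
      _ ≤ ∑ j, min |⟪x - y, h j⟫| (relu ⟪x, h j⟫) := hh.le_sum_min _ _
      _ ≤ ∑ j, |relu ⟪x, h j⟫ - relu ⟪y, h j⟫| := by
        refine Finset.sum_le_sum fun j _ => ?_
        rw [inner_sub_left]
        exact min_abs_relu_le_abs_relu_sub_relu _ _
  by_cases hx : ‖x - y‖ / 2 ≤ ‖x‖
  · exact key x y hx
  · have hy : ‖y - x‖ / 2 ≤ ‖y‖ := by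
      rw [norm_sub_rev]
      have := norm_sub_le x y
      linarith
    have := key y x hy
    simpa only [norm_sub_rev y x, abs_sub_comm (relu ⟪y, h _⟫)] using this

/-- A small set of coordinates carries little of the change of a well-conditioned layer. -/
theorem sum_abs_relu_sub_le (hh : IsWellConditioned h) {S : Finset (Fin m)}
    (hS : (S.card : ℝ) ≤ 1 / 2 ^ 28 * m) (x y : E) :
    ∑ j ∈ S, |relu ⟪x, h j⟫ - relu ⟪y, h j⟫| ≤ m / 4096 * ‖x - y‖ := by
  have hsqrt : √(m : ℝ) ^ 2 = m := Real.sq_sqrt (Nat.cast_nonneg m)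
  have hcard : √(S.card : ℝ) ≤ √m / 2 ^ 14 := by
    refine Real.sqrt_le_iff.2 ⟨by positivity, hS.trans_eq ?_⟩
    rw [div_pow, hsqrt]
    ring
  calc ∑ j ∈ S, |relu ⟪x, h j⟫ - relu ⟪y, h j⟫|
      ≤ ∑ j ∈ S, |⟪x - y, h j⟫| := by
        refine Finset.sum_le_sum fun j _ => ?_
        rw [inner_sub_left]
        exact abs_relu_sub_relu_le _ _
    _ ≤ √S.card * (4 * √m) * ‖x - y‖ := by
        refine sum_abs_inner_le (by positivity) (fun p => (hh.sum_sq_le p).trans_eq ?_) S _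
        rw [mul_pow, hsqrt]
        ring
    _ ≤ √m / 2 ^ 14 * (4 * √m) * ‖x - y‖ := by gcongr
    _ = √(m : ℝ) ^ 2 / 4096 * ‖x - y‖ := by ring
    _ = m / 4096 * ‖x - y‖ := by rw [hsqrt]

end IsWellConditioned

/-! ### Gaussian matrices are well conditioned -/

variable [FiniteDimensional ℝ E] [MeasurableSpace E] [BorelSpace E]

/-- Chernoff with t = 1/4: the base is e⁻¹ · 3/2 ≤ 3/4. -/
theorem measureReal_pi_sum_sq_ge_le {m : ℕ} {v : E} (hv : ‖v‖ = 1) :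
    (Measure.pi fun _ : Fin m => stdGaussian E).real {h | 4 * m ≤ ∑ j, ⟪v, h j⟫ ^ 2} ≤
      (7 / 8) ^ m := by
  refine (measureReal_pi_sum_ge_le (f := fun x => ⟪v, x⟫ ^ 2) (by fun_prop) (t := 1 / 4)
    (by norm_num) (integrable_exp_inner_sq hv) 4).trans ?_
  refine pow_le_pow_left₀ (mul_nonneg (Real.exp_pos _).le mgf_nonneg) ?_ m
  have hexp : Real.exp (-(1 / 4) * 4) ≤ 1 / 2 := by
    rw [show -(1 / 4) * 4 = (-1 : ℝ) by norm_num, Real.exp_neg, one_div]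
    gcongr
    linarith [Real.add_one_le_exp (1 : ℝ)]
  calc _ ≤ (1 / 2 : ℝ) * (3 / 2) :=
        mul_le_mul hexp (mgf_inner_sq_le hv) mgf_nonneg (by norm_num)
    _ ≤ 7 / 8 := by norm_num

/-- Chernoff with t = -32; the threshold 1/448 makes the base e^(1/14) · 13/16 ≤ (14/13)(13/16) =
7/8. -/
theorem measureReal_pi_sum_min_le_le {m : ℕ} {p q : E} (hp : ‖p‖ = 1) (hq : ‖q‖ = 1) :
    (Measure.pi fun _ : Fin m => stdGaussian E).real
      {h | ∑ j, min |⟪p, h j⟫| (relu ⟪q, h j⟫) ≤ 1 / 448 * m} ≤ (7 / 8) ^ m := by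
  refine (measureReal_pi_sum_le_le (measurable_min_inner p q) (t := -32)
    (by norm_num) (integrable_exp_min_inner p q) (1 / 448)).trans ?_
  refine pow_le_pow_left₀ (mul_nonneg (Real.exp_pos _).le mgf_nonneg) ?_ m
  have hexp : Real.exp (- -32 * (1 / 448)) ≤ 14 / 13 := by
    rw [show - -32 * (1 / 448) = (1 / 14 : ℝ) by norm_num]
    have h := Real.add_one_le_exp (-(1 / 14) : ℝ)
    rw [← neg_neg (1 / 14 : ℝ), Real.exp_neg]
    calc (Real.exp (-(1 / 14)))⁻¹ ≤ (13 / 14 : ℝ)⁻¹ := by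
          gcongr
          linarith
      _ = 14 / 13 := by norm_num
  calc _ ≤ (14 / 13 : ℝ) * (13 / 16) :=
        mul_le_mul hexp (mgf_min_inner_le hp hq) mgf_nonneg (by norm_num)
    _ = 7 / 8 := by norm_num

theorem measureReal_pi_not_isWellConditioned_le {m k : ℕ} (hk : 1 ≤ k)
    (hdim : Module.finrank ℝ E = k + 1) (hm : 912 * k ≤ m) :
    (Measure.pi fun _ : Fin m => stdGaussian E).real {h | ¬ IsWellConditioned h} ≤
      Real.exp (-(m / 15)) := by
  obtain ⟨N, hcard, hunit, hcover⟩ := exists_unit_net (E := E) (η := 1 / 7168) (by norm_num)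
  set μ := Measure.pi fun _ : Fin m => stdGaussian E
  have hsub : {h : Fin m → E | ¬ IsWellConditioned h} ⊆
      (⋃ v ∈ N, {h : Fin m → E | 4 * m ≤ ∑ j, ⟪v, h j⟫ ^ 2}) ∪
      ⋃ z ∈ N ×ˢ N, {h : Fin m → E | ∑ j, min |⟪z.1, h j⟫| (relu ⟪z.2, h j⟫) ≤ 1 / 448 * m} := by
    intro h hh
    by_contra hout
    simp only [Set.mem_union, Set.mem_iUnion, Set.mem_ofPred_eq, not_or, not_exists, not_le,
      Finset.mem_product, Prod.forall] at hout
    exact hh (isWellConditioned_of_net hcover (fun v hv => (hout.1 v hv).le)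
      fun v hv w hw => (hout.2 v w ⟨hv, hw⟩).le)
  have hN : (N.card : ℝ) ≤ 2 ^ (14 * (k + 1)) := by
    refine hcard.trans ?_
    rw [hdim, pow_mul]
    gcongr
    norm_num
  have hone : (1 : ℝ) ≤ 2 ^ (14 * (k + 1)) := one_le_pow₀ (by norm_num)
  -- Since 2 ≤ (16/15)¹⁶ and 912 = 16 · 57, the expansion pays for all pairs from the net, leaving
  -- the rate (16/15)(7/8) = 14/15.
  have hcount : (N.card : ℝ) + N.card * N.card ≤ (16 / 15) ^ m := by
    calc (N.card : ℝ) + N.card * N.card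
        ≤ 2 ^ (14 * (k + 1)) * 2 ^ (14 * (k + 1)) + 2 ^ (14 * (k + 1)) * 2 ^ (14 * (k + 1)) := by
          gcongr
          nlinarith
      _ = 2 ^ (28 * k + 29) := by ring
      _ ≤ 2 ^ (57 * k) := by
          gcongr
          · norm_num
          · omega
      _ ≤ ((16 / 15) ^ 16) ^ (57 * k) := by
          gcongr
          norm_num
      _ = (16 / 15) ^ (912 * k) := by
          rw [← pow_mul]
          ring_nf
      _ ≤ (16 / 15) ^ m := by
          gcongr
          norm_num
  calc μ.real {h | ¬ IsWellConditioned h}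
      ≤ N.card * (7 / 8) ^ m + N.card * N.card * (7 / 8) ^ m := by
        refine (measureReal_mono hsub).trans ((measureReal_union_le _ _).trans ?_)
        refine add_le_add ((measureReal_biUnion_finset_le _ _).trans ?_)
          ((measureReal_biUnion_finset_le _ _).trans ?_)
        · rw [← nsmul_eq_mul]
          exact Finset.sum_le_card_nsmul _ _ _ fun v hv =>
            measureReal_pi_sum_sq_ge_le (hunit v hv)
        · rw [← Nat.cast_mul, ← Finset.card_product, ← nsmul_eq_mul]
          refine Finset.sum_le_card_nsmul _ _ _ fun z hz => ?_
          obtain ⟨h1, h2⟩ := Finset.mem_product.1 hz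
          exact measureReal_pi_sum_min_le_le (hunit _ h1) (hunit _ h2)
    _ = (N.card + N.card * N.card) * (7 / 8) ^ m := by ring
    _ ≤ (16 / 15) ^ m * (7 / 8) ^ m := by gcongr
    _ = (14 / 15) ^ m := by
        rw [← mul_pow]
        norm_num
    _ ≤ Real.exp (-(1 / 15)) ^ m := by
        gcongr
        linarith [Real.add_one_le_exp (-(1 / 15) : ℝ)]
    _ = Real.exp (-(m / 15)) := by
        rw [← Real.exp_nat_mul]
        ring_nf

end WellConditioned

/-! ### The layers of a network -/

section Layer

open scoped RealInnerProductSpace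

/-- The input of a layer, with an additional coordinate `1` that multiplies the bias. -/
def augment {k : ℕ} (x : Fin k → ℝ) : EuclideanSpace ℝ (Option (Fin k)) :=
  WithLp.toLp 2 fun o => o.elim 1 x

theorem augment_injective {k : ℕ} : Function.Injective (augment (k := k)) := by
  intro x y hxy
  ext l
  have := congrArg (fun v : EuclideanSpace ℝ (Option (Fin k)) => v (some l)) hxy
  simpa [augment] using this

variable {d : ℕ} {n : Fin (d + 1) → ℕ}

/-- The `j`-th row of weights of layer `i`, together with the corresponding bias. -/
def layerRow (H : Weights n) (δ : Biases n) (i : Fin d) (j : Fin (n i.succ)) :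
    EuclideanSpace ℝ (Option (Fin (n i.castSucc))) :=
  WithLp.toLp 2 fun o => o.elim (δ i j) (H i j)

theorem inner_augment_layerRow (H : Weights n) (δ : Biases n) (i : Fin d)
    (x : Fin (n i.castSucc) → ℝ) (j : Fin (n i.succ)) :
    ⟪augment x, layerRow H δ i j⟫ = (Matrix.mulVec (H i) x + δ i) j := by
  simp [augment, layerRow, PiLp.inner_apply, Fintype.sum_option, Matrix.mulVec, dotProduct,
    add_comm]

theorem layerOutput_succ (H : Weights n) (δ : Biases n) (z : Fin (n 0) → ℝ) (i : Fin d)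
    (j : Fin (n i.succ)) :
    layerOutput H δ z i.succ j =
      relu ⟪augment (layerOutput H δ z i.castSucc), layerRow H δ i j⟫ := by
  rw [inner_augment_layerRow]
  rfl

/-- Equal outputs make the lower Lipschitz bound zero, which forces equal inputs layer by layer. -/
theorem layerOutput_injective {H : Weights n} {δ : Biases n} (hn : ∀ i : Fin d, 0 < n i.succ)
    (hwc : ∀ i, IsWellConditioned (layerRow H δ i)) (i : Fin (d + 1)) :
    Function.Injective fun z => layerOutput H δ z i := by
  induction i using Fin.induction with
  | zero => exact fun z w hzw => hzw
  | succ i ih =>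
    intro z w hzw
    refine ih (augment_injective ?_)
    have hle := (hwc i).le_sum_abs_relu_sub (augment (layerOutput H δ z i.castSucc))
      (augment (layerOutput H δ w i.castSucc))
    simp only [← layerOutput_succ] at hle
    have hzero : ∑ j, |layerOutput H δ z i.succ j - layerOutput H δ w i.succ j| = 0 :=
      Finset.sum_eq_zero fun j _ => by
        rw [show layerOutput H δ z i.succ = layerOutput H δ w i.succ from hzw, sub_self, abs_zero]
    rw [hzero] at hle
    have hpos : (0 : ℝ) < n i.succ / 1792 := by
      have := hn i
      positivity
    have := nonpos_of_mul_nonpos_right hle hpos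
    exact sub_eq_zero.1 (norm_le_zero_iff.1 this)

/-- The error on its own support can be compensated only partially by a change of the input. -/
theorem l1Norm_lt_of_sum_support_lt {m : ℕ} {Δ e : Fin m → ℝ}
    (h : 2 * ∑ j with e j ≠ 0, |Δ j| < ∑ j, |Δ j|) : l1Norm e < l1Norm (Δ - e) := by
  have hterm : ∀ j, |e j| + |Δ j| - 2 * (if e j ≠ 0 then |Δ j| else 0) ≤ |(Δ - e) j| := by
    intro j
    rw [Pi.sub_apply]
    split_ifs with hj
    · have := abs_sub_abs_le_abs_sub (e j) (Δ j)
      rw [abs_sub_comm] at this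
      linarith
    · rw [not_not.1 hj]
      simp
  have hsum := Finset.sum_le_sum fun j (_ : j ∈ Finset.univ) => hterm j
  rw [Finset.sum_sub_distrib, Finset.sum_add_distrib, ← Finset.mul_sum, ← Finset.sum_filter]
    at hsum
  unfold l1Norm
  linarith

theorem isUniqueMinimizer_generator {d : ℕ} {n : Fin (d + 1 + 1) → ℕ} {H : Weights n}
    {δ : Biases n} (hn : ∀ i : Fin (d + 1), 0 < n i.succ)
    (hwc : ∀ i, IsWellConditioned (layerRow H δ i)) (z₀ : Fin (n 0) → ℝ)
    {e : Fin (n (Fin.last (d + 1))) → ℝ}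
    (he : (hammingNorm e : ℝ) ≤ 1 / 2 ^ 28 * (n (Fin.last (d + 1)) : ℝ)) :
    IsUniqueMinimizer (fun z => l1Norm (generator H δ z - (generator H δ z₀ + e))) z₀ := by
  have hself : l1Norm (generator H δ z₀ - (generator H δ z₀ + e)) = l1Norm e := by
    rw [sub_add_cancel_left]
    simp [l1Norm]
  have hstrict : ∀ z, z ≠ z₀ → l1Norm (generator H δ z₀ - (generator H δ z₀ + e)) <
      l1Norm (generator H δ z - (generator H δ z₀ + e)) := by
    intro z hz
    rw [hself, ← sub_sub]
    refine l1Norm_lt_of_sum_support_lt ?_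
    let i := Fin.last d
    set x := augment (layerOutput H δ z i.castSucc)
    set y := augment (layerOutput H δ z₀ i.castSucc)
    have hxy : x ≠ y := fun heq =>
      hz (layerOutput_injective hn hwc i.castSucc (augment_injective heq))
    have hpos : 0 < ‖x - y‖ := norm_pos_iff.2 (sub_ne_zero.2 hxy)
    have hlow := (hwc i).le_sum_abs_relu_sub x y
    have hup := (hwc i).sum_abs_relu_sub_le (S := Finset.univ.filter fun j => e j ≠ 0) he x y
    simp only [x, y, ← layerOutput_succ] at hlow hup
    have hm : (0 : ℝ) < n i.succ := Nat.cast_pos.2 (hn i)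
    -- The constants are matched here: 2/4096 = 1/2048 < 1/1792.
    have hlt : 2 * ((n i.succ : ℝ) / 4096 * ‖x - y‖) < n i.succ / 1792 * ‖x - y‖ := by
      have := mul_pos hm hpos
      linarith
    calc _ ≤ 2 * ((n i.succ : ℝ) / 4096 * ‖x - y‖) := mul_le_mul_of_nonneg_left hup (by norm_num)
      _ < _ := hlt
      _ ≤ _ := hlow
  refine ⟨fun z => ?_, fun z hmin => ?_⟩
  · rcases eq_or_ne z z₀ with rfl | hz
    · exact le_rfl
    · exact (hstrict z hz).le
  · by_contra hz
    exact (hmin z₀).not_gt (hstrict z hz)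

variable {Ω : Type*} [MeasurableSpace Ω] {P : Measure Ω} {H : Ω → Weights n} {δ : Ω → Biases n}

/-- The parameters of layer i, with the bias at `none`, form an injectively indexed subfamily of the
independent parameters; currying splits it into independent rows. -/
theorem IsGaussianNetwork.hasLaw_layerRow (h : IsGaussianNetwork H δ P) (i : Fin d) :
    HasLaw (fun ω => layerRow (H ω) (δ ω) i) (Measure.pi fun _ => stdGaussian _) P := by
  let idx : Fin (n i.succ) × Option (Fin (n i.castSucc)) → ParamIndex n :=
    fun s => s.2.elim (Sum.inr ⟨i, s.1⟩) fun l => Sum.inl ⟨i, s.1, l⟩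
  have hinj : Function.Injective idx := by
    rintro ⟨j, _ | l⟩ ⟨j', _ | l'⟩ heq <;> simp_all [idx]
  have hflat : HasLaw (fun ω s => param (H ω) (δ ω) (idx s))
      (Measure.pi fun _ => gaussianReal 0 1) P :=
    (h.indep.precomp hinj).hasLaw_pi fun s => h.law (idx s)
  have hcurry : MeasurePreserving
      (MeasurableEquiv.curry (Fin (n i.succ)) (Option (Fin (n i.castSucc))) ℝ)
      (Measure.pi fun _ => gaussianReal 0 1)
      (Measure.pi fun _ => Measure.pi fun _ => gaussianReal 0 1) := by
    refine ⟨MeasurableEquiv.measurable _, ?_⟩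
    have := Measure.infinitePi_map_curry
      fun (_ : Fin (n i.succ)) (_ : Option (Fin (n i.castSucc))) => gaussianReal 0 1
    simpa only [Measure.infinitePi_eq_pi] using this
  have hlp : MeasurePreserving
      (fun (f : Fin (n i.succ) → Option (Fin (n i.castSucc)) → ℝ) j => WithLp.toLp 2 (f j))
      (Measure.pi fun _ => Measure.pi fun _ => gaussianReal 0 1)
      (Measure.pi fun _ => stdGaussian _) :=
    measurePreserving_pi _ _ fun _ => ⟨by fun_prop, map_pi_eq_stdGaussian⟩
  refine (hlp.comp hcurry).comp_hasLaw hflat |>.congr (Filter.Eventually.of_forall fun ω => ?_)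
  ext j o
  cases o <;> rfl

theorem IsGaussianNetwork.measureReal_not_isWellConditioned_le [IsProbabilityMeasure P]
    (h : IsGaussianNetwork H δ P) (i : Fin d) (hpos : 1 ≤ n i.castSucc)
    (hexp : 912 * n i.castSucc ≤ n i.succ) :
    P.real {ω | ¬ IsWellConditioned (layerRow (H ω) (δ ω) i)} ≤
      Real.exp (-(n i.succ / 15)) := by
  have hlaw := h.hasLaw_layerRow i
  have hdim : Module.finrank ℝ (EuclideanSpace ℝ (Option (Fin (n i.castSucc)))) =
      n i.castSucc + 1 := by simp
  refine le_trans ?_ (measureReal_pi_not_isWellConditioned_le hpos hdim hexp)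
  refine ENNReal.toReal_mono (measure_ne_top _ _) ?_
  rw [← hlaw.map_eq]
  -- This inequality holds for arbitrary sets, so the bad event need not be shown measurable.
  exact Measure.le_map_apply hlaw.aemeasurable _

end Layer

/-! ### Layer widths -/

theorem le_width_of_expansion {d : ℕ} {n : Fin (d + 1) → ℕ} (h0 : 1 ≤ n 0)
    (hn : ∀ i : Fin d, 912 * n i.castSucc ≤ n i.succ) (i : Fin (d + 1)) :
    912 * (i : ℕ) ≤ n i ∧ n 0 ≤ n i := by
  induction i using Fin.induction with
  | zero => simp
  | succ i ih =>
    have := hn i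
    rw [Fin.val_castSucc] at ih
    rw [Fin.val_succ]
    omega

theorem width_zero_eq_prod_mul_width_last {d : ℕ} {w : Fin (d + 1) → ℝ} {r : Fin d → ℝ}
    (h : ∀ i : Fin d, w i.castSucc = r i * w i.succ) : w 0 = (∏ i, r i) * w (Fin.last d) := by
  induction d with
  | zero => simp
  | succ d ih =>
    rw [Fin.prod_univ_succ, mul_assoc, ← Fin.succ_last,
      ← ih (w := fun i => w i.succ) (r := fun i => r i.succ) fun i => h i.succ]
    exact h 0

theorem sum_fin_half_pow_le (d : ℕ) : ∑ i : Fin d, (1 / 2 : ℝ) ^ ((i : ℕ) + 1) ≤ 1 := by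
  rw [Fin.sum_univ_eq_sum_range fun i => (1 / 2 : ℝ) ^ (i + 1)]
  have h : ∀ d : ℕ, ∑ i ∈ Finset.range d, (1 / 2 : ℝ) ^ (i + 1) = 1 - (1 / 2) ^ d := by
    intro d
    induction d with
    | zero => simp
    | succ d ih =>
      rw [Finset.sum_range_succ, ih]
      ring
  rw [h]
  have : (0 : ℝ) ≤ (1 / 2) ^ d := by positivity
  linarith

/-- One half of the exponent n_i/15 yields e^(-n₀/30), the other a geometric factor at most 2⁻ⁱ.
Thus the sum has no prefactor d, which would spoil the bound for small widths. -/
theorem sum_exp_width_le {d : ℕ} {n : Fin (d + 1) → ℕ} (h0 : 1 ≤ n 0)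
    (hn : ∀ i : Fin d, 912 * n i.castSucc ≤ n i.succ) :
    ∑ i : Fin d, Real.exp (-(n i.succ / 15)) ≤ Real.exp (-(n 0 / 30)) := by
  have hhalf : Real.exp (-1) ≤ 1 / 2 := by
    rw [Real.exp_neg, one_div]
    gcongr
    linarith [Real.add_one_le_exp (1 : ℝ)]
  calc ∑ i : Fin d, Real.exp (-(n i.succ / 15))
      ≤ ∑ i : Fin d, (1 / 2 : ℝ) ^ ((i : ℕ) + 1) * Real.exp (-(n 0 / 30)) := by
        refine Finset.sum_le_sum fun i _ => ?_
        obtain ⟨h1, h2⟩ := le_width_of_expansion h0 hn i.succ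
        have h1' : (912 : ℝ) * ((i : ℕ) + 1) ≤ n i.succ := by
          rw [Fin.val_succ] at h1
          exact_mod_cast h1
        have h2' : (n 0 : ℝ) ≤ n i.succ := Nat.cast_le.2 h2
        calc Real.exp (-(n i.succ / 15))
            ≤ Real.exp (((i : ℕ) + 1 : ℕ) * -1 + -(n 0 / 30)) := by
              rw [Real.exp_le_exp]
              push_cast
              linarith
          _ = Real.exp (-1) ^ ((i : ℕ) + 1) * Real.exp (-(n 0 / 30)) := by
              rw [Real.exp_add, Real.exp_nat_mul]
          _ ≤ (1 / 2 : ℝ) ^ ((i : ℕ) + 1) * Real.exp (-(n 0 / 30)) := by gcongr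
    _ ≤ Real.exp (-(n 0 / 30)) := by
        rw [← Finset.sum_mul]
        exact mul_le_of_le_one_left (Real.exp_pos _).le (sum_fin_half_pow_le d)

end

/-! ### Union bound over the layers -/

theorem mainTheorem2 :
    ∃ ε : ℝ, 0 < ε ∧
      ∀ (d : ℕ), 1 ≤ d →
      ∀ (α : Fin d → ℝ), (∀ i, 0 < α i ∧ α i < 1 ∧ 1 - α i < ε) →
      ∃ c ρ : ℝ, 0 < c ∧ 0 < ρ ∧
        ∀ (n : Fin (d + 1) → ℕ),
          (∀ i : Fin d, (n i.succ : ℝ) / (n i.castSucc : ℝ) = 1 / (1 - α i)) →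
        ∀ (z₀ : Fin (n 0) → ℝ)
          (Ω : Type*) [MeasurableSpace Ω] (P : Measure Ω) [IsProbabilityMeasure P]
          (H : Ω → Weights n) (δ : Ω → Biases n), IsGaussianNetwork H δ P →
          1 - Real.exp (-c * (n (Fin.last d) : ℝ)) ≤
            P.real {ω | ∀ e : Fin (n (Fin.last d)) → ℝ,
              (hammingNorm e : ℝ) ≤ ρ * (n (Fin.last d) : ℝ) →
              IsUniqueMinimizer
                (fun z => l1Norm (generator (H ω) (δ ω) z - (generator (H ω) (δ ω) z₀ + e)))
                z₀} := by
  refine ⟨1 / 912, by norm_num, fun d hd α hα => ?_⟩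
  obtain ⟨d, rfl⟩ : ∃ d', d = d' + 1 := ⟨d - 1, by omega⟩
  have hα' : ∀ i, 0 < 1 - α i := fun i => by linarith [(hα i).2.1]
  -- As n₀ = ∏(1 - α_i) · n, this c turns the bound e^(-n₀/30) into e^(-cn).
  refine ⟨(∏ i, (1 - α i)) / 30, 1 / 2 ^ 28,
    div_pos (Finset.prod_pos fun i _ => hα' i) (by norm_num), by positivity, ?_⟩
  intro n hn z₀ Ω _ P _ H δ hG
  -- Positivity of the widths is implicit in the ratio condition: division by zero gives 0, not 1/(1
  -- - α_i) > 0.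
  have hpos : ∀ i : Fin (d + 1), 0 < n i.castSucc := fun i => by
    rw [Nat.pos_iff_ne_zero]
    intro h0
    have h := hn i
    rw [h0, Nat.cast_zero, div_zero] at h
    exact (one_div_pos.2 (hα' i)).ne h
  have hratio : ∀ i : Fin (d + 1), (n i.castSucc : ℝ) = (1 - α i) * n i.succ := fun i => by
    have hi : (0 : ℝ) < n i.castSucc := Nat.cast_pos.2 (hpos i)
    have h := hn i
    rw [div_eq_div_iff hi.ne' (hα' i).ne'] at h
    linarith
  have hexp : ∀ i : Fin (d + 1), 912 * n i.castSucc ≤ n i.succ := fun i => by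
    have h : (912 * n i.castSucc : ℝ) ≤ n i.succ := by
      rw [hratio i]
      have := mul_le_mul_of_nonneg_right (hα i).2.2.le (Nat.cast_nonneg (α := ℝ) (n i.succ))
      linarith
    exact_mod_cast h
  have h0 : 1 ≤ n 0 := hpos 0
  have hsucc : ∀ i : Fin (d + 1), 0 < n i.succ := fun i => by
    have := hexp i
    have := hpos i
    omega
  set G := {ω | ∀ e : Fin (n (Fin.last (d + 1))) → ℝ,
    (hammingNorm e : ℝ) ≤ 1 / 2 ^ 28 * (n (Fin.last (d + 1)) : ℝ) →
    IsUniqueMinimizer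
      (fun z => l1Norm (generator (H ω) (δ ω) z - (generator (H ω) (δ ω) z₀ + e))) z₀}
  have hcover : Set.univ ⊆ G ∪
      ⋃ i ∈ Finset.univ, {ω | ¬ IsWellConditioned (layerRow (H ω) (δ ω) i)} := by
    intro ω _
    by_cases hω : ∀ i, IsWellConditioned (layerRow (H ω) (δ ω) i)
    · exact Or.inl fun e he => isUniqueMinimizer_generator hsucc hω z₀ he
    · obtain ⟨i, hi⟩ := not_forall.1 hω
      exact Or.inr (Set.mem_biUnion (Finset.mem_coe.2 (Finset.mem_univ i)) hi)
  have hbad : P.real (⋃ i ∈ Finset.univ, {ω | ¬ IsWellConditioned (layerRow (H ω) (δ ω) i)}) ≤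
      Real.exp (-(n 0 / 30)) :=
    (measureReal_biUnion_finset_le _ _).trans ((Finset.sum_le_sum fun i _ =>
      hG.measureReal_not_isWellConditioned_le i (hpos i) (hexp i)).trans
      (sum_exp_width_le h0 hexp))
  have hone : 1 ≤ P.real G + Real.exp (-(n 0 / 30)) := by
    rw [← probReal_univ (μ := P)]
    exact (measureReal_mono hcover).trans ((measureReal_union_le _ _).trans (by gcongr))
  have hrate : -((∏ i, (1 - α i)) / 30) * (n (Fin.last (d + 1)) : ℝ) = -((n 0 : ℝ) / 30) := by
    rw [width_zero_eq_prod_mul_width_last (w := fun i => (n i : ℝ)) hratio]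
    ring
  rw [hrate]
  linarith
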